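/- Let $n,m\in\mathbb N_0$, $X=\mathbb R^n$, $U=\mathbb R^m$ (with Euclidean norms), let $Y$ be a real normed space, and let $\mathcal U=L^\infty([0,\infty),U)$ be the space of essentially bounded Lebesgue measurable inputs with the essential supremum norm. Consider the system $\dot x=f(x,u)$, $y=h(x)$, where $h\colon X\to Y$ is continuous and $f\colon X\times U\to X$ is Lipschitz in the first variable on bounded sets: for every $r>0$ there is $L(r)>0$ with $\|f(x_1,v)-f(x_2,v)\|\le L(r)\|x_1-x_2\|$ whenever $\|x_1\|,\|x_2\|,\|v\|<r$. Solutions are understood in the Carathéodory sense: $\xi$ is a solution on $[0,T]$ with initial state $x$ and input $u$ if $s\mapsto f(\xi(s),u(s))$ is integrable on $[0,T]$ and $\xi(t)=x+\int_0^t f(\xi(s),u(s))\,ds$ for all $t\in[0,T]$. Such solutions are unique. Assume that the system is forward complete, i.e. for all $x\in X$, $u\in\mathcal U$ and $t\ge 0$ the solution $\phi(\cdot,x,u)$ exists on $[0,t]$, and put $y(t,x,u)=h(\phi(t,x,u))$. Let $\mathcal K_\infty$ be the set of continuous, strictly increasing, unbounded functions $\gamma\colon[0,\infty)\to[0,\infty)$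 with $\gamma(0)=0$. Then the following are equivalent. (OUAG) There is $\gamma\in\mathcal K_\infty$ such that for all $\varepsilon,r,s>0$ there is $\tau=\tau(\varepsilon,r,s)\ge 0$ with $$\|y(t,x,u)\|\le\varepsilon+\gamma(\|u\|_\infty)\quad\text{for all } \|x\|<r,\ u\in\mathcal U \text{ with } \|u\|_\infty<s,\ t\ge\tau.$$ (OGUAG) There is $\gamma\in\mathcal K_\infty$ such that for all $\varepsilon,r>0$ there is $\tau=\tau(\varepsilon,r)\ge 0$ with $$\|y(t,x,u)\|\le\varepsilon+\gamma(\|u\|_\infty)\quad\text{for all } \|x\|<r,\ u\in\mathcal U,\ t\ge\tau.$$ (The gains $\gamma$ in the two properties may differ.) -/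

import Mathlib

namespace OutputStability

open MeasureTheory Set
open scoped ENNReal NNReal

/-! ### Comparison functions and asymptotic gain properties of output maps -/

/-- Class `K_∞`: continuous, strictly increasing, unbounded, zero at zero. -/
structure IsClassKInf (γ : ℝ≥0 → ℝ≥0) : Prop where
  map_zero : γ 0 = 0
  continuous : Continuous γ
  strictMono : StrictMono γ
  unbounded : ¬ BddAbove (range γ)

section AsymptoticGain

variable {X Input Y : Type*} [NormedAddCommGroup X] [NormedAddCommGroup Input]
  [NormedAddCommGroup Y]

/-- Output-uniform asymptotic gain property of the outputs `y t x u`, `t ∈ [0, ∞)`. -/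
def OUAG (y : ℝ → X → Input → Y) : Prop :=
  ∃ γ : ℝ≥0 → ℝ≥0, IsClassKInf γ ∧
    ∀ ε r s : ℝ, 0 < ε → 0 < r → 0 < s → ∃ τ : ℝ, 0 ≤ τ ∧
      ∀ x : X, ‖x‖ < r → ∀ u : Input, ‖u‖ < s → ∀ t : ℝ, τ ≤ t →
        ‖y t x u‖ ≤ ε + γ ‖u‖₊

/-- Output-global uniform asymptotic gain property of the outputs `y t x u`, `t ∈ [0, ∞)`. -/
def OGUAG (y : ℝ → X → Input → Y) : Prop :=
  ∃ γ : ℝ≥0 → ℝ≥0, IsClassKInf γ ∧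
    ∀ ε r : ℝ, 0 < ε → 0 < r → ∃ τ : ℝ, 0 ≤ τ ∧
      ∀ x : X, ‖x‖ < r → ∀ u : Input, ∀ t : ℝ, τ ≤ t →
        ‖y t x u‖ ≤ ε + γ ‖u‖₊

end AsymptoticGain

/-! ### Finite-dimensional systems `x' = f(x, u)`, `y = h(x)` -/

/-- The state space and the input-value space. -/
abbrev Euc (n : ℕ) : Type := EuclideanSpace ℝ (Fin n)

/-- The input space: essentially bounded Lebesgue measurable functions `[0, ∞) → ℝᵐ`
(up to equality almost everywhere), with the essential supremum norm. -/
abbrev InputSpace (m : ℕ) : Type := Lp (Euc m) ∞ (volume.restrict (Ici (0 : ℝ)))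

/-- The data `f`, `h` of the system `x' = f(x, u)`, `y = h(x)`: the right-hand side `f` is
Lipschitz in the state on bounded sets of states and input values, and `h` is continuous. -/
structure FinSystem (n m : ℕ) (Y : Type*) [NormedAddCommGroup Y] where
  f : Euc n → Euc m → Euc n
  h : Euc n → Y
  lipschitz : ∀ r : ℝ, 0 < r → ∃ L : ℝ, 0 < L ∧
    ∀ x₁ x₂ : Euc n, ∀ v : Euc m, ‖x₁‖ < r → ‖x₂‖ < r → ‖v‖ < r →
      ‖f x₁ v - f x₂ v‖ ≤ L * ‖x₁ - x₂‖
  continuous_h : Continuous h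

namespace FinSystem

variable {n m : ℕ} {Y : Type*} [NormedAddCommGroup Y]

/-- `ξ` is a (Carathéodory) solution on `[0, T]` of `ξ' = f(ξ, u)`, `ξ(0) = x`: the function
`s ↦ f(ξ(s), u(s))` is integrable, and `ξ(t) = x + ∫₀ᵗ f(ξ(s), u(s)) ds` on `[0, T]`. -/
def IsSolution (S : FinSystem n m Y) (x : Euc n) (u : InputSpace m) (T : ℝ) (ξ : ℝ → Euc n) :
    Prop :=
  IntervalIntegrable (fun s => S.f (ξ s) (u s)) volume 0 T ∧
    ∀ t ∈ Icc 0 T, ξ t = x + ∫ s in (0 : ℝ)..t, S.f (ξ s) (u s)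

/-- The system is forward complete: for all initial states and inputs, the solution exists up to
every time `t ≥ 0`. -/
def ForwardComplete (S : FinSystem n m Y) : Prop :=
  ∀ (x : Euc n) (u : InputSpace m) (t : ℝ), 0 ≤ t → ∃ ξ : ℝ → Euc n, S.IsSolution x u t ξ

open Classical in
/-- The transition map: the value at time `t` of the solution (unique by `isSolution_unique`) with
initial state `x` and input `u`. It has the junk value `0` where no solution on `[0, t]` exists. -/
noncomputable def flow (S : FinSystem n m Y) (t : ℝ) (x : Euc n) (u : InputSpace m) : Euc n :=
  if hex : ∃ ξ : ℝ → Euc n, S.IsSolution x u t ξ then hex.choose t else 0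

/-- The output `y(t, x, u) = h(φ(t, x, u))`. -/
noncomputable def output (S : FinSystem n m Y) (t : ℝ) (x : Euc n) (u : InputSpace m) : Y :=
  S.h (S.flow t x u)

/-! Well-definedness of the transition map: solutions are unique. -/

theorem IsSolution.continuousOn {S : FinSystem n m Y} {x : Euc n} {u : InputSpace m} {T : ℝ}
    {ξ : ℝ → Euc n} (hξ : S.IsSolution x u T ξ) (hT : 0 ≤ T) : ContinuousOn ξ (Icc 0 T) := by
  have h1 := intervalIntegral.continuousOn_primitive_interval' hξ.1 left_mem_uIcc
  rw [uIcc_of_le hT] at h1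
  exact (continuousOn_const.add h1).congr hξ.2

theorem IsSolution.mono {S : FinSystem n m Y} {x : Euc n} {u : InputSpace m} {T T' : ℝ}
    {ξ : ℝ → Euc n} (hξ : S.IsSolution x u T ξ) (h0 : 0 ≤ T') (h : T' ≤ T) :
    S.IsSolution x u T' ξ := by
  refine ⟨hξ.1.mono_set ?_, fun t ht => hξ.2 t ⟨ht.1, ht.2.trans h⟩⟩
  rw [uIcc_of_le h0, uIcc_of_le (h0.trans h)]
  exact Icc_subset_Icc_right h

theorem isSolution_unique (S : FinSystem n m Y) {x : Euc n} {u : InputSpace m} {T : ℝ}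
    {ξ₁ ξ₂ : ℝ → Euc n} (h₁ : S.IsSolution x u T ξ₁) (h₂ : S.IsSolution x u T ξ₂) :
    ∀ t ∈ Icc 0 T, ξ₁ t = ξ₂ t := by
  intro t₀ ht₀
  have hT : 0 ≤ T := ht₀.1.trans ht₀.2
  have c₁ := h₁.continuousOn hT
  have c₂ := h₂.continuousOn hT
  obtain ⟨R₁, hR₁⟩ := isCompact_Icc.exists_bound_of_continuousOn c₁
  obtain ⟨R₂, hR₂⟩ := isCompact_Icc.exists_bound_of_continuousOn c₂
  have hR₁0 : 0 ≤ R₁ := (norm_nonneg _).trans (hR₁ t₀ ht₀)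
  have hR₂0 : 0 ≤ R₂ := (norm_nonneg _).trans (hR₂ t₀ ht₀)
  have hu0 : 0 ≤ ‖u‖ := norm_nonneg u
  obtain ⟨L, hL, hLip⟩ := S.lipschitz (R₁ + R₂ + ‖u‖ + 1) (by linarith)
  have hu : ∀ᵐ s ∂(volume.restrict (Ici (0 : ℝ))), ‖u s‖ ≤ ‖u‖ := by
    have h1 := ae_le_eLpNormEssSup (f := u) (μ := volume.restrict (Ici (0 : ℝ)))
    filter_upwards [h1] with s hs
    rw [Lp.norm_def, eLpNorm_exponent_top]
    have hfin : eLpNormEssSup u (volume.restrict (Ici (0 : ℝ))) ≠ ∞ := by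
      rw [← eLpNorm_exponent_top]
      exact Lp.eLpNorm_ne_top u
    have h2 := ENNReal.toReal_mono hfin hs
    simpa using h2
  have hu' : ∀ᵐ s : ℝ, s ∈ Ici (0 : ℝ) → ‖u s‖ ≤ ‖u‖ :=
    (ae_restrict_iff' measurableSet_Ici).1 hu
  let g₀ : ℝ → ℝ := fun s => ‖ξ₁ s - ξ₂ s‖
  have cg₀ : ContinuousOn g₀ (Icc 0 T) := (c₁.sub c₂).norm
  let g : ℝ → ℝ := IccExtend hT ((Icc 0 T).domRestrict g₀)
  have cg : Continuous g := cg₀.domRestrict.Icc_extend'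
  have hg : ∀ s ∈ Icc 0 T, g s = g₀ s := fun s hs => by
    simp [g, IccExtend_of_mem hT _ hs, domRestrict_apply]
  have hGd : ∀ s, HasDerivAt (fun t => ∫ r in (0 : ℝ)..t, g r) (g s) s := fun s =>
    intervalIntegral.integral_hasDerivAt_right (cg.intervalIntegrable _ _)
      cg.aestronglyMeasurable.stronglyMeasurableAtFilter cg.continuousAt
  have key : ∀ t ∈ Icc 0 T, g t ≤ L * ∫ r in (0 : ℝ)..t, g r := by
    intro t ht
    have i₁ := (h₁.mono ht.1 ht.2).1
    have i₂ := (h₂.mono ht.1 ht.2).1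
    rw [hg t ht]
    have e : ξ₁ t - ξ₂ t
        = ∫ s in (0 : ℝ)..t, (S.f (ξ₁ s) (u s) - S.f (ξ₂ s) (u s)) := by
      rw [intervalIntegral.integral_sub i₁ i₂, h₁.2 t ht, h₂.2 t ht]
      abel
    change ‖ξ₁ t - ξ₂ t‖ ≤ _
    rw [e, ← intervalIntegral.integral_const_mul]
    refine intervalIntegral.norm_integral_le_of_norm_le ht.1 ?_
      ((cg.const_mul L).intervalIntegrable _ _)
    filter_upwards [hu'] with s hs hst
    have hsT : s ∈ Icc 0 T := ⟨hst.1.le, hst.2.trans ht.2⟩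
    rw [hg s hsT]
    have b₁ := hR₁ s hsT
    have b₂ := hR₂ s hsT
    have b₃ := hs hst.1.le
    exact hLip _ _ _ (by linarith) (by linarith) (by linarith)
  have hG0 : ∀ t ∈ Icc 0 T, 0 ≤ ∫ r in (0 : ℝ)..t, g r := fun t ht =>
    intervalIntegral.integral_nonneg ht.1 fun s hs => by
      rw [hg s ⟨hs.1, hs.2.trans ht.2⟩]
      exact norm_nonneg _
  have hz := eq_zero_of_abs_deriv_le_mul_abs_self_of_eq_zero_right
    (f := fun t => ∫ r in (0 : ℝ)..t, g r) (f' := g) (K := L) (a := 0) (b := T)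
    (fun s _ => (hGd s).continuousAt.continuousWithinAt)
    (fun s _ => (hGd s).hasDerivWithinAt) (by simp)
    (fun s hs => by
      have hs' : s ∈ Icc 0 T := Ico_subset_Icc_self hs
      have hgs : 0 ≤ g s := by rw [hg s hs']; exact norm_nonneg _
      rw [Real.norm_of_nonneg hgs, Real.norm_of_nonneg (hG0 s hs')]
      exact key s hs') t₀ ht₀
  have h3 := key t₀ ht₀
  rw [hz, mul_zero, hg t₀ ht₀] at h3
  exact sub_eq_zero.1 (norm_le_zero_iff.1 h3)

/-- The transition map evaluates every solution. -/
theorem flow_eq (S : FinSystem n m Y) {x : Euc n} {u : InputSpace m} {T t : ℝ} {ξ : ℝ → Euc n}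
    (hξ : S.IsSolution x u T ξ) (ht : t ∈ Icc 0 T) : S.flow t x u = ξ t := by
  have hex : ∃ ξ : ℝ → Euc n, S.IsSolution x u t ξ := ⟨ξ, hξ.mono ht.1 ht.2⟩
  rw [flow, dif_pos hex]
  exact S.isSolution_unique hex.choose_spec (hξ.mono ht.1 ht.2) t ⟨ht.1, le_rfl⟩

end FinSystem

end OutputStability

/-! Only the passage from OUAG to OGUAG has content. Inputs with `‖u‖ < max r 1` are covered by
OUAG. For larger ones `‖x‖ < r ≤ ‖u‖`, so it suffices to bound the output by a function of `‖u‖`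
alone, valid at all times, and to absorb that function into the gain (`IsClassKInf.exists_ge`). OUAG
supplies such a bound at late times. At early times it comes from boundedness of the reachable set
over bounded sets of states, inputs and times.

That boundedness (`ForwardComplete.boundedReach`) is the crux. As `f` need not be continuous in the
input value, it is not obtained from limits of inputs. Suppose the set reachable from `p` is
unbounded. By compactness the same holds, for the remaining time, at some limit of states reached
after a short time (`ForwardComplete.exists_not_boundedReach`). Iteration yields a pseudo-orbit `P
j` with jumps below `(1/4)^(j+1)`. Short-time transition maps are close to the identity, hence cover
balls (`surjOn_closedBall_of_norm_sub_sub_le`), so under the concatenated input a true trajectory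
shadows the pseudo-orbit (`exists_forall_iterateSeq_mem`). Forward completeness bounds this
trajectory on `[0, T]`. Hence the `P j` are bounded and the step lengths bounded below, although
they sum to at most `T`: a contradiction. -/

namespace OutputStability

open MeasureTheory Set
open scoped ENNReal NNReal

/-! ### Scalar tools: Grönwall and a barrier argument -/

/-- Grönwall's inequality in integral form. -/
theorem le_mul_exp_of_le_add_mul_integral {g : ℝ → ℝ} {T δ L : ℝ} (hT : 0 ≤ T) (hL : 0 ≤ L)
    (hg : ContinuousOn g (Icc 0 T)) (h0 : ∀ t ∈ Icc 0 T, 0 ≤ g t)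
    (h : ∀ t ∈ Icc 0 T, g t ≤ δ + L * ∫ s in (0 : ℝ)..t, g s) :
    ∀ t ∈ Icc 0 T, g t ≤ δ * Real.exp (L * t) := by
  -- The continuous extension makes the primitive differentiable everywhere. Grönwall is applied to
  -- the majorant `δ + L * ∫ G`, since `g` itself need not be differentiable.
  let G : ℝ → ℝ := IccExtend hT ((Icc 0 T).domRestrict g)
  have cG : Continuous G := hg.domRestrict.Icc_extend'
  have hG : ∀ s ∈ Icc 0 T, G s = g s := fun s hs => by
    simp [G, IccExtend_of_mem hT _ hs, domRestrict_apply]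
  have hint : ∀ t ∈ Icc 0 T, ∫ s in (0 : ℝ)..t, G s = ∫ s in (0 : ℝ)..t, g s := fun t ht => by
    refine intervalIntegral.integral_congr fun s hs => ?_
    rw [uIcc_of_le ht.1] at hs
    exact hG s ⟨hs.1, hs.2.trans ht.2⟩
  have hδ : 0 ≤ δ := by
    have h1 := h 0 ⟨le_rfl, hT⟩
    have h2 := h0 0 ⟨le_rfl, hT⟩
    simp at h1
    linarith
  have hd : ∀ s, HasDerivAt (fun t => δ + L * ∫ r in (0 : ℝ)..t, G r) (L * G s) s := fun s =>
    ((intervalIntegral.integral_hasDerivAt_right (cG.intervalIntegrable _ _)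
      cG.aestronglyMeasurable.stronglyMeasurableAtFilter cG.continuousAt).const_mul L).const_add δ
  intro t ht
  have key := norm_le_gronwallBound_of_norm_deriv_right_le
    (f := fun t => δ + L * ∫ r in (0 : ℝ)..t, G r) (f' := fun s => L * G s) (K := L) (a := 0)
    (b := T) (δ := δ) (ε := 0) (fun s _ => (hd s).continuousAt.continuousWithinAt)
    (fun s _ => (hd s).hasDerivWithinAt) (by simp [abs_of_nonneg hδ])
    (fun s hs => by
      have hs' : s ∈ Icc 0 T := Ico_subset_Icc_self hs
      have h1 : 0 ≤ G s := by rw [hG s hs']; exact h0 s hs'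
      rw [Real.norm_of_nonneg (mul_nonneg hL h1), add_zero]
      refine mul_le_mul_of_nonneg_left ?_ hL
      refine le_trans ?_ (Real.le_norm_self _)
      rw [hint s hs', hG s hs']
      exact h s hs') t ht
  rw [gronwallBound_ε0, sub_zero] at key
  refine (h t ht).trans ?_
  rw [← hint t ht]
  exact (Real.le_norm_self _).trans key

/-- A continuous function that cannot reach the level `ρ` first at any time stays below `ρ`. -/
theorem forall_lt_of_forall_Ico_lt {g : ℝ → ℝ} {T ρ : ℝ} (hg : ContinuousOn g (Icc 0 T))
    (h : ∀ t ∈ Icc 0 T, (∀ s ∈ Ico 0 t, g s < ρ) → g t < ρ) : ∀ t ∈ Icc 0 T, g t < ρ := by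
  by_contra! hcon
  obtain ⟨t₁, ht₁, hρ⟩ := hcon
  have hc : IsCompact (Icc 0 T ∩ g ⁻¹' Ici ρ) :=
    isCompact_Icc.of_isClosed_subset (hg.preimage_isClosed_of_isClosed isClosed_Icc isClosed_Ici)
      inter_subset_left
  obtain ⟨t₀, ⟨ht₀, hge⟩, hmin⟩ := hc.exists_isLeast ⟨t₁, ht₁, hρ⟩
  refine absurd (h t₀ ht₀ fun s hs => ?_) (not_lt.2 hge)
  by_contra! hs'
  exact absurd (hmin ⟨⟨hs.1, hs.2.le.trans ht₀.2⟩, hs'⟩) (not_le.2 hs.2)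

/-! ### Trajectories of bounded measurable input functions -/

namespace FinSystem

variable {n m : ℕ} {Y : Type*} [NormedAddCommGroup Y]

/-- `u` is a measurable input function with values in the closed ball of radius `R`. -/
structure Admissible (R : ℝ) (u : ℝ → Euc m) : Prop where
  measurable : Measurable u
  norm_le : ∀ s, ‖u s‖ ≤ R

/-- `ξ` is a solution on `[0, ∞)` with initial state `x` for the input function `u`. -/
def IsTrajectory (S : FinSystem n m Y) (x : Euc n) (u : ℝ → Euc m) (ξ : ℝ → Euc n) : Prop :=
  ∀ T : ℝ, 0 ≤ T → IntervalIntegrable (fun s => S.f (ξ s) (u s)) volume 0 T ∧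
    ξ T = x + ∫ s in (0 : ℝ)..T, S.f (ξ s) (u s)

variable {S : FinSystem n m Y} {x x₁ x₂ : Euc n} {u u₁ u₂ : ℝ → Euc m} {ξ ξ₁ ξ₂ : ℝ → Euc n}
  {R T L r : ℝ}

theorem Admissible.shift (hu : Admissible R u) (s : ℝ) : Admissible R fun t => u (t + s) :=
  ⟨hu.measurable.comp (measurable_id.add_const s), fun _ => hu.norm_le _⟩

theorem IsTrajectory.map_zero (h : S.IsTrajectory x u ξ) : ξ 0 = x := by
  simpa using (h 0 le_rfl).2

theorem IsTrajectory.continuousOn (h : S.IsTrajectory x u ξ) (T : ℝ) :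
    ContinuousOn ξ (Icc 0 T) := by
  rcases lt_or_ge T 0 with hT | hT
  · simp [Icc_eq_empty (not_le.2 hT)]
  have h1 := intervalIntegral.continuousOn_primitive_interval' (h T hT).1 left_mem_uIcc
  rw [uIcc_of_le hT] at h1
  exact (continuousOn_const.add h1).congr fun t ht => (h t ht.1).2

theorem IsTrajectory.shift (h : S.IsTrajectory x u ξ) {s : ℝ} (hs : 0 ≤ s) :
    S.IsTrajectory (ξ s) (fun t => u (t + s)) (fun t => ξ (t + s)) := by
  intro T hT
  have i₁ := (h s hs).1
  have i₂ := (h (T + s) (by linarith)).1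
  have i₃ := i₁.symm.trans i₂
  refine ⟨?_, ?_⟩
  · have := i₃.comp_add_right s
    simpa using this
  · have e : ∫ t in (0 : ℝ)..T, S.f (ξ (t + s)) (u (t + s))
        = ∫ t in s..(T + s), S.f (ξ t) (u t) := by
      rw [intervalIntegral.integral_comp_add_right (fun t => S.f (ξ t) (u t)), zero_add]
    change ξ (T + s) = ξ s + ∫ t in (0 : ℝ)..T, S.f (ξ (t + s)) (u (t + s))
    rw [e, (h (T + s) (by linarith)).2, (h s hs).2, add_assoc,
      intervalIntegral.integral_add_adjacent_intervals i₁ i₃]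

/-- Subtracting `x₁ - x₂` leaves only the integral of the difference of the right-hand sides. The
estimate serves both Grönwall and the comparison of the flow with the identity. The bounds are
required only before `T`, as a barrier argument provides them. -/
theorem IsTrajectory.norm_sub_sub_le (h₁ : S.IsTrajectory x₁ u₁ ξ₁)
    (h₂ : S.IsTrajectory x₂ u₂ ξ₂) (hT : 0 ≤ T) (hu : ∀ s ∈ Ico 0 T, u₁ s = u₂ s)
    (hr : ∀ s, ‖u₁ s‖ < r)
    (hL : ∀ x₁ x₂ : Euc n, ∀ v : Euc m, ‖x₁‖ < r → ‖x₂‖ < r → ‖v‖ < r →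
      ‖S.f x₁ v - S.f x₂ v‖ ≤ L * ‖x₁ - x₂‖)
    (hb₁ : ∀ s ∈ Ico 0 T, ‖ξ₁ s‖ < r) (hb₂ : ∀ s ∈ Ico 0 T, ‖ξ₂ s‖ < r) :
    ‖ξ₁ T - ξ₂ T - (x₁ - x₂)‖ ≤ L * ∫ s in (0 : ℝ)..T, ‖ξ₁ s - ξ₂ s‖ := by
  have e : ξ₁ T - ξ₂ T - (x₁ - x₂)
      = ∫ s in (0 : ℝ)..T, (S.f (ξ₁ s) (u₁ s) - S.f (ξ₂ s) (u₂ s)) := by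
    rw [intervalIntegral.integral_sub (h₁ T hT).1 (h₂ T hT).1, (h₁ T hT).2, (h₂ T hT).2]
    abel
  rw [e, ← intervalIntegral.integral_const_mul]
  refine intervalIntegral.norm_integral_le_of_norm_le hT ?_ ?_
  · filter_upwards [(measure_eq_zero_iff_ae_notMem.1 (measure_singleton (μ := volume) T))]
      with s hsT hs
    have hs' : s ∈ Ico 0 T := ⟨hs.1.le, lt_of_le_of_ne hs.2 hsT⟩
    rw [← hu s hs']
    exact hL _ _ _ (hb₁ s hs') (hb₂ s hs') (hr s)
  · have hc := (((h₁.continuousOn T).sub (h₂.continuousOn T)).norm).const_mul L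
    rw [← uIcc_of_le hT] at hc
    exact hc.intervalIntegrable

theorem IsTrajectory.norm_sub_le (h₁ : S.IsTrajectory x₁ u₁ ξ₁)
    (h₂ : S.IsTrajectory x₂ u₂ ξ₂) (hT : 0 ≤ T) (hu : ∀ s ∈ Ico 0 T, u₁ s = u₂ s)
    (hr : ∀ s, ‖u₁ s‖ < r) (hL0 : 0 ≤ L)
    (hL : ∀ x₁ x₂ : Euc n, ∀ v : Euc m, ‖x₁‖ < r → ‖x₂‖ < r → ‖v‖ < r →
      ‖S.f x₁ v - S.f x₂ v‖ ≤ L * ‖x₁ - x₂‖)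
    (hb₁ : ∀ s ∈ Ico 0 T, ‖ξ₁ s‖ < r) (hb₂ : ∀ s ∈ Ico 0 T, ‖ξ₂ s‖ < r) :
    ∀ t ∈ Icc 0 T, ‖ξ₁ t - ξ₂ t‖ ≤ ‖x₁ - x₂‖ * Real.exp (L * t) := by
  refine le_mul_exp_of_le_add_mul_integral hT hL0
    ((h₁.continuousOn T).sub (h₂.continuousOn T)).norm (fun _ _ => norm_nonneg _) fun t ht => ?_
  have h3 := h₁.norm_sub_sub_le h₂ ht.1 (fun s hs => hu s ⟨hs.1, hs.2.trans_le ht.2⟩) hr hL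
    (fun s hs => hb₁ s ⟨hs.1, hs.2.trans_le ht.2⟩) (fun s hs => hb₂ s ⟨hs.1, hs.2.trans_le ht.2⟩)
  have h4 := norm_sub_norm_le (ξ₁ t - ξ₂ t) (x₁ - x₂)
  linarith

/-- Stability with respect to the initial state along a trajectory bounded by `r - 1`. -/
theorem IsTrajectory.norm_sub_le_of_mul_exp_lt (h₁ : S.IsTrajectory x₁ u₁ ξ₁)
    (h₂ : S.IsTrajectory x₂ u₂ ξ₂) (hu : ∀ s ∈ Ico 0 T, u₁ s = u₂ s)
    (hr : ∀ s, ‖u₁ s‖ < r) (hL0 : 0 ≤ L)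
    (hL : ∀ x₁ x₂ : Euc n, ∀ v : Euc m, ‖x₁‖ < r → ‖x₂‖ < r → ‖v‖ < r →
      ‖S.f x₁ v - S.f x₂ v‖ ≤ L * ‖x₁ - x₂‖)
    (hb : ∀ s ∈ Icc 0 T, ‖ξ₁ s‖ ≤ r - 1) (hx : ‖x₁ - x₂‖ * Real.exp (L * T) < 1) :
    ∀ t ∈ Icc 0 T, ‖ξ₁ t - ξ₂ t‖ ≤ ‖x₁ - x₂‖ * Real.exp (L * t) := by
  -- Bootstrap: while the distance is below `1`, the second trajectory stays in the ball of radius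
  -- `r`, where `L` applies; the resulting estimate in turn keeps the distance below `1`.
  have hbd : ∀ t, 0 ≤ t → t ≤ T → (∀ s ∈ Ico 0 t, ‖ξ₁ s - ξ₂ s‖ < 1) →
      ‖ξ₁ t - ξ₂ t‖ ≤ ‖x₁ - x₂‖ * Real.exp (L * t) := by
    intro t ht0 ht hlt
    refine h₁.norm_sub_le h₂ ht0 (fun s hs => hu s ⟨hs.1, hs.2.trans_le ht⟩) hr hL0 hL
      (fun s hs => ?_) (fun s hs => ?_) t ⟨ht0, le_rfl⟩
    · linarith [hb s ⟨hs.1, hs.2.le.trans ht⟩]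
    · have h1 := hb s ⟨hs.1, hs.2.le.trans ht⟩
      have h2 := hlt s hs
      have h3 := norm_sub_norm_le (ξ₂ s) (ξ₁ s)
      rw [norm_sub_rev] at h3
      linarith
  have hlt := forall_lt_of_forall_Ico_lt (g := fun t => ‖ξ₁ t - ξ₂ t‖) (T := T) (ρ := 1)
    ((h₁.continuousOn T).sub (h₂.continuousOn T)).norm (fun t ht hs => by
      refine (hbd t ht.1 ht.2 hs).trans_lt (lt_of_le_of_lt ?_ hx)
      gcongr
      exact ht.2)
  exact fun t ht => hbd t ht.1 ht.2 fun s hs => hlt s ⟨hs.1, hs.2.le.trans ht.2⟩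

/-- Trajectories are unique and causal. -/
theorem IsTrajectory.eq_of_eqOn (h₁ : S.IsTrajectory x u₁ ξ₁)
    (h₂ : S.IsTrajectory x u₂ ξ₂) (hu : ∀ s ∈ Ico 0 T, u₁ s = u₂ s) (hR : Admissible R u₁) :
    ∀ t ∈ Icc 0 T, ξ₁ t = ξ₂ t := by
  intro t ht
  obtain ⟨B, hB⟩ := isCompact_Icc.exists_bound_of_continuousOn (h₁.continuousOn T)
  have hB0 : 0 ≤ B := (norm_nonneg _).trans (hB t ht)
  have hR0 : 0 ≤ R := (norm_nonneg _).trans (hR.norm_le 0)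
  obtain ⟨L, hL0, hL⟩ := S.lipschitz (B + R + 1) (by linarith)
  have := h₁.norm_sub_le_of_mul_exp_lt h₂ hu (r := B + R + 1)
    (fun s => by linarith [hR.norm_le s]) hL0.le hL (fun s hs => by linarith [hB s hs])
    (by simp) t ht
  simpa [sub_eq_zero] using this

theorem IsTrajectory.isSolution_of_ae_eq (h : S.IsTrajectory x u ξ) {U : InputSpace m}
    (hU : U =ᵐ[volume.restrict (Ici (0 : ℝ))] u) (hT : 0 ≤ T) : S.IsSolution x U T ξ := by
  have hae : ∀ t, 0 ≤ t → (fun s => S.f (ξ s) (u s)) =ᵐ[volume.restrict (uIoc 0 t)]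
      fun s => S.f (ξ s) (U s) := fun t ht => by
    have h1 : uIoc 0 t ⊆ Ici (0 : ℝ) := by
      rw [uIoc_of_le ht]; exact fun s hs => hs.1.le
    filter_upwards [ae_restrict_of_ae_restrict_of_subset h1 hU] with s hs
    rw [hs]
  refine ⟨(h T hT).1.congr_ae (hae T hT), fun t ht => ?_⟩
  rw [(h t ht.1).2, intervalIntegral.integral_congr_ae_restrict (hae t ht.1)]

/-- By uniqueness the solutions on different intervals `[0, T]` agree, so the flow itself is a
trajectory for all times. -/
theorem ForwardComplete.exists_isTrajectory (hFC : S.ForwardComplete) (hu : Admissible R u)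
    (x : Euc n) : ∃ ξ, S.IsTrajectory x u ξ := by
  have hmem : MemLp u ∞ (volume.restrict (Ici (0 : ℝ))) :=
    memLp_top_of_bound hu.measurable.aestronglyMeasurable R (.of_forall hu.norm_le)
  have hU := hmem.coeFn_toLp
  set U : InputSpace m := hmem.toLp u
  refine ⟨fun t => S.flow t x U, fun T hT => ?_⟩
  obtain ⟨ξ, hξ⟩ := hFC x U T hT
  have hae : (fun s => S.f (ξ s) (U s)) =ᵐ[volume.restrict (uIoc 0 T)]
      fun s => S.f (S.flow s x U) (u s) := by
    have h1 : uIoc 0 T ⊆ Ici (0 : ℝ) := by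
      rw [uIoc_of_le hT]; exact fun s hs => hs.1.le
    filter_upwards [ae_restrict_of_ae_restrict_of_subset h1 hU,
      ae_restrict_mem measurableSet_uIoc] with s hs hs'
    rw [uIoc_of_le hT] at hs'
    rw [hs, S.flow_eq hξ ⟨hs'.1.le, hs'.2⟩]
  refine ⟨hξ.1.congr_ae hae, ?_⟩
  change S.flow T x U = _
  rw [S.flow_eq hξ ⟨hT, le_rfl⟩, hξ.2 T ⟨hT, le_rfl⟩,
    intervalIntegral.integral_congr_ae_restrict hae]

/-- Along every essentially bounded input, the transition map is the trajectory of a bounded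
input function. -/
theorem ForwardComplete.exists_isTrajectory_flow (hFC : S.ForwardComplete) (x : Euc n)
    (U : InputSpace m) (hU : ‖U‖ ≤ R) :
    ∃ u ξ, Admissible R u ∧ S.IsTrajectory x u ξ ∧ ∀ t, 0 ≤ t → S.flow t x U = ξ t := by
  have hR0 : 0 ≤ R := (norm_nonneg _).trans hU
  have hm : Measurable U := (Lp.stronglyMeasurable U).measurable
  have hs : MeasurableSet {s | ‖U s‖ ≤ R} := measurableSet_le hm.norm measurable_const
  -- Replacing the representative by `0` where it exceeds `R` changes it only on a null subset of
  -- `[0, ∞)`.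
  let u : ℝ → Euc m := indicator {s | ‖U s‖ ≤ R} U
  have hu : Admissible R u := ⟨hm.indicator hs, fun s => by
    by_cases h : ‖U s‖ ≤ R
    · simp [u, h]
    · simpa [u, indicator, h] using hR0⟩
  have hae : U =ᵐ[volume.restrict (Ici (0 : ℝ))] u := by
    have h1 := ae_le_eLpNormEssSup (f := U) (μ := volume.restrict (Ici (0 : ℝ)))
    filter_upwards [h1] with s hs
    have hfin : eLpNormEssSup U (volume.restrict (Ici (0 : ℝ))) ≠ ∞ := by
      rw [← eLpNorm_exponent_top]
      exact Lp.eLpNorm_ne_top U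
    have h2 := ENNReal.toReal_mono hfin hs
    have h3 : ‖U s‖ ≤ ‖U‖ := by
      rw [Lp.norm_def, eLpNorm_exponent_top]
      simpa using h2
    simp [u, h3.trans hU]
  obtain ⟨ξ, hξ⟩ := hFC.exists_isTrajectory hu x
  exact ⟨u, ξ, hu, hξ, fun t ht => S.flow_eq (hξ.isSolution_of_ae_eq hae ht) ⟨ht, le_rfl⟩⟩

end FinSystem

/-! ### Covering maps and shadowing orbits -/

/-- A map that is `1/2`-close to the identity in the Lipschitz sense on a closed ball covers the
ball of half the radius about the image of the centre. -/
theorem surjOn_closedBall_of_norm_sub_sub_le {E : Type*} [NormedAddCommGroup E] [NormedSpace ℝ E]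
    [CompleteSpace E] {F : E → E} {b : E} {d : ℝ} (hd : 0 ≤ d)
    (hF : ∀ x ∈ Metric.closedBall b d, ∀ y ∈ Metric.closedBall b d,
      ‖F x - F y - (x - y)‖ ≤ 1 / 2 * ‖x - y‖) :
    SurjOn F (Metric.closedBall b d) (Metric.closedBall (F b) (d / 2)) := by
  intro z hz
  have hz' : ‖z - F b‖ ≤ d / 2 := by rw [← dist_eq_norm]; exact hz
  -- Fixed points of this `1/2`-contraction are the solutions of `F x = z`.
  let Φ : E → E := fun x => x - F x + z
  have hlip : ∀ x ∈ Metric.closedBall b d, ∀ y ∈ Metric.closedBall b d,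
      dist (Φ x) (Φ y) ≤ 1 / 2 * dist x y := fun x hx y hy => by
    have e : Φ x - Φ y = -(F x - F y - (x - y)) := by simp only [Φ]; abel
    rw [dist_eq_norm, dist_eq_norm, e, norm_neg]
    exact hF x hx y hy
  have hb : b ∈ Metric.closedBall b d := Metric.mem_closedBall_self hd
  have hmaps : MapsTo Φ (Metric.closedBall b d) (Metric.closedBall b d) := fun x hx => by
    have h1 := hlip x hx b hb
    have h2 : dist (Φ b) b ≤ d / 2 := by
      have e : Φ b - b = z - F b := by simp only [Φ]; abel
      rw [dist_eq_norm, e]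
      exact hz'
    have h3 := dist_triangle (Φ x) (Φ b) b
    rw [Metric.mem_closedBall] at hx ⊢
    linarith
  have hc : ContractingWith (1 / 2) (hmaps.restrict Φ _ _) := by
    refine ⟨by rw [← NNReal.coe_lt_coe]; norm_num, LipschitzWith.of_dist_le_mul fun x y => ?_⟩
    simpa [Subtype.dist_eq] using hlip x x.2 y y.2
  obtain ⟨x, hx, hfix, -⟩ := hc.exists_fixedPoint' (s := Metric.closedBall b d)
    (Metric.isClosed_closedBall.isComplete) hmaps hb (edist_ne_top _ _)
  refine ⟨x, hx, ?_⟩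
  have h1 : x - F x + z = x := hfix
  have h2 : z - F x = 0 := by
    have : x - F x + z - x = 0 := by rw [h1, sub_self]
    rw [← this]; abel
  exact (sub_eq_zero.1 h2).symm

/-- The states reached after `j` steps of the time-varying map `F`. -/
def iterateSeq {E : Type*} (F : ℕ → E → E) : ℕ → E → E
  | 0 => id
  | j + 1 => F j ∘ iterateSeq F j

/-- If each `F j` maps the `j`-th compact set onto a superset of the next one, some orbit runs
through all these sets. -/
theorem exists_forall_iterateSeq_mem {E : Type*} [TopologicalSpace E] [T2Space E]
    {F : ℕ → E → E} {C : ℕ → Set E} (hF : ∀ j, Continuous (F j)) (hC : ∀ j, IsCompact (C j))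
    (hne : ∀ j, (C j).Nonempty) (hsurj : ∀ j, SurjOn (F j) (C j) (C (j + 1))) :
    ∃ x, ∀ j, iterateSeq F j x ∈ C j := by
  have hcont : ∀ j, Continuous (iterateSeq F j) := fun j => by
    induction j with
    | zero => exact continuous_id
    | succ j ih => exact (hF j).comp ih
  -- Finite orbit segments are found by pulling a point of the last set backwards; the infinite
  -- orbit then follows from Cantor's intersection theorem in `C 0`.
  have hex : ∀ j, ∀ z ∈ C j, ∃ x, (∀ i ≤ j, iterateSeq F i x ∈ C i) ∧ iterateSeq F j x = z := by
    intro j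
    induction j with
    | zero =>
      intro z hz
      refine ⟨z, fun i hi => ?_, rfl⟩
      obtain rfl : i = 0 := by omega
      exact hz
    | succ j ih =>
      intro z hz
      obtain ⟨y, hy, rfl⟩ := hsurj j hz
      obtain ⟨x, hx, hxy⟩ := ih y hy
      have hlast : iterateSeq F (j + 1) x = F j y := by rw [← hxy]; rfl
      refine ⟨x, fun i hi => ?_, hlast⟩
      rcases Nat.lt_or_ge j i with h | h
      · obtain rfl : i = j + 1 := by omega
        rw [hlast]; exact hz
      · exact hx i h
  let K : ℕ → Set E := fun j => {x | ∀ i ≤ j, iterateSeq F i x ∈ C i}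
  have hclosed : ∀ j, IsClosed (K j) := fun j => by
    have : K j = ⋂ i, ⋂ (_ : i ≤ j), iterateSeq F i ⁻¹' C i := by ext; simp [K]
    rw [this]
    exact isClosed_iInter fun i => isClosed_iInter fun _ => (hC i).isClosed.preimage (hcont i)
  obtain ⟨x, hx⟩ := IsCompact.nonempty_iInter_of_sequence_nonempty_isCompact_isClosed K
    (fun j x hx i hi => hx i (hi.trans j.le_succ))
    (fun j => by
      obtain ⟨z, hz⟩ := hne j
      obtain ⟨x, hx, -⟩ := hex j z hz
      exact ⟨x, hx⟩)
    ((hC 0).of_isClosed_subset (hclosed 0) fun x hx => hx 0 le_rfl) hclosed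
  exact ⟨x, fun j => mem_iInter.1 hx j j le_rfl⟩

/-! ### Bounds on the right-hand side and short-time estimates -/

namespace FinSystem

variable {n m : ℕ} {Y : Type*} [NormedAddCommGroup Y]
variable {S : FinSystem n m Y}

/-- The right-hand side of a forward complete system is bounded at the origin over bounded sets
of input values: otherwise some input makes it grow like `1 / s` as `s → 0`. -/
theorem ForwardComplete.exists_norm_f_zero_le (hFC : S.ForwardComplete) (r : ℝ) :
    ∃ M, ∀ v, ‖v‖ < r → ‖S.f 0 v‖ ≤ M := by
  by_contra! hcon
  choose v hv hf using fun k : ℕ => hcon (k + 1)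
  have hu : Admissible r fun s : ℝ => v ⌊s⁻¹⌋₊ :=
    ⟨(measurable_from_nat (f := v)).comp (Nat.measurable_floor.comp measurable_inv),
      fun s => (hv _).le⟩
  obtain ⟨ξ, hξ⟩ := hFC.exists_isTrajectory hu 0
  have hr0 : 0 < r := (norm_nonneg _).trans_lt (hv 0)
  obtain ⟨L, hL0, hL⟩ := S.lipschitz (r + 1) (by linarith)
  have hc : ContinuousWithinAt ξ (Icc 0 1) 0 := hξ.continuousOn 1 0 (by simp)
  obtain ⟨δ, hδ, hball⟩ := Metric.continuousWithinAt_iff.1 hc 1 one_pos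
  let η : ℝ := min (δ / 2) 1
  have hη : 0 < η := lt_min (by linarith) one_pos
  have hi := (hξ η hη.le).1
  -- Near time `0` the state has norm below `1`, so `s⁻¹ ≤ ‖f(ξ(s), u(s))‖ + L`. Integrability along
  -- the solution would make `s⁻¹` integrable at `0`.
  have hinv : IntervalIntegrable (fun s : ℝ => s⁻¹) volume 0 η := by
    refine (hi.norm.add (intervalIntegrable_const (c := L))).mono_fun'
      measurable_inv.aestronglyMeasurable ?_
    filter_upwards [ae_restrict_mem measurableSet_uIoc] with s hs
    rw [uIoc_of_le hη.le] at hs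
    have hsξ : ‖ξ s‖ < 1 := by
      have := hball (x := s) ⟨hs.1.le, hs.2.trans (min_le_right _ _)⟩ (by
        rw [Real.dist_eq, sub_zero, abs_of_pos hs.1]
        linarith [hs.2, min_le_left (δ / 2) 1])
      rwa [hξ.map_zero, dist_zero_right] at this
    have h1 := hL (ξ s) 0 (v ⌊s⁻¹⌋₊) (by linarith) (by simpa using by linarith)
      ((hv _).trans (by linarith))
    have h2 := hf ⌊s⁻¹⌋₊
    have h3 := (Nat.lt_floor_add_one s⁻¹)
    have h4 := norm_sub_norm_le (S.f 0 (v ⌊s⁻¹⌋₊)) (S.f (ξ s) (v ⌊s⁻¹⌋₊))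
    rw [norm_sub_rev] at h4
    have h5 : L * ‖ξ s - 0‖ ≤ L := by
      rw [sub_zero]; exact mul_le_of_le_one_right hL0.le hsξ.le
    rw [Real.norm_of_nonneg (inv_nonneg.2 hs.1.le)]
    linarith
  rcases intervalIntegrable_inv_iff.1 hinv with h | h
  · exact hη.ne h
  · exact h left_mem_uIcc

theorem ForwardComplete.exists_norm_f_le (hFC : S.ForwardComplete) (r : ℝ) :
    ∃ M, 0 < M ∧ ∀ x v, ‖x‖ < r → ‖v‖ < r → ‖S.f x v‖ ≤ M := by
  rcases le_or_gt r 0 with hr | hr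
  · exact ⟨1, one_pos, fun x _ hx => absurd ((norm_nonneg x).trans_lt hx) (not_lt.2 hr)⟩
  obtain ⟨M, hM⟩ := hFC.exists_norm_f_zero_le r
  obtain ⟨L, hL0, hL⟩ := S.lipschitz r hr
  refine ⟨|M| + L * r + 1, by positivity, fun x v hx hv => ?_⟩
  have h1 := hL x 0 v hx (by simpa using hr) hv
  have h2 := hM v hv
  have h3 := norm_sub_norm_le (S.f x v) (S.f 0 v)
  have h4 : L * ‖x - 0‖ ≤ L * r := by
    rw [sub_zero]; exact mul_le_mul_of_nonneg_left hx.le hL0.le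
  linarith [le_abs_self M]

/-- Over short times, trajectories that start in a ball stay in a slightly larger ball, and the
transition map is Lipschitz-close to the identity. -/
theorem ForwardComplete.exists_short_time (hFC : S.ForwardComplete) (R ρ : ℝ) :
    ∃ η, 0 < η ∧
      (∀ x u ξ, ‖x‖ ≤ ρ → Admissible R u → S.IsTrajectory x u ξ →
        ∀ t ∈ Icc 0 η, ‖ξ t‖ < ρ + 1) ∧
      ∀ x₁ x₂ u ξ₁ ξ₂, ‖x₁‖ ≤ ρ → ‖x₂‖ ≤ ρ → Admissible R u → S.IsTrajectory x₁ u ξ₁ →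
        S.IsTrajectory x₂ u ξ₂ → ‖ξ₁ η - ξ₂ η - (x₁ - x₂)‖ ≤ 1 / 2 * ‖x₁ - x₂‖ := by
  let r := |R| + |ρ| + 1
  have hr : 0 < r := by positivity
  obtain ⟨M, hM0, hM⟩ := hFC.exists_norm_f_le r
  obtain ⟨L, hL0, hL⟩ := S.lipschitz r hr
  -- The first bound limits the displacement to `1/2`. The second gives `L * η ≤ 1/8`, so distances
  -- grow at most by the factor `e ≤ 3` and the deviation from the identity is at most `3/8 ≤ 1/2`.
  let η := min (1 / (2 * M)) (1 / (8 * L))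
  have hη : 0 < η := by positivity
  have hηM : M * η < 1 := by
    have : M * η ≤ M * (1 / (2 * M)) := mul_le_mul_of_nonneg_left (min_le_left _ _) hM0.le
    have e : M * (1 / (2 * M)) = 1 / 2 := by field_simp
    linarith
  have hηL : L * η ≤ 1 / 8 := by
    have : L * η ≤ L * (1 / (8 * L)) := mul_le_mul_of_nonneg_left (min_le_right _ _) hL0.le
    have e : L * (1 / (8 * L)) = 1 / 8 := by field_simp
    linarith
  have hur : ∀ u : ℝ → Euc m, Admissible R u → ∀ s, ‖u s‖ < r := fun u hu s => by
    have := hu.norm_le s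
    simp only [r]
    linarith [le_abs_self R, abs_nonneg ρ]
  have hρr : ρ + 1 ≤ r := by simp only [r]; linarith [le_abs_self ρ, abs_nonneg R]
  have hbd : ∀ x u ξ, ‖x‖ ≤ ρ → Admissible R u → S.IsTrajectory x u ξ →
      ∀ t ∈ Icc 0 η, ‖ξ t‖ < ρ + 1 := by
    intro x u ξ hx hu hξ
    refine forall_lt_of_forall_Ico_lt (hξ.continuousOn η).norm fun t ht hs => ?_
    have h1 : ‖∫ s in (0 : ℝ)..t, S.f (ξ s) (u s)‖ ≤ ∫ _ in (0 : ℝ)..t, M := by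
      refine intervalIntegral.norm_integral_le_of_norm_le ht.1 ?_ intervalIntegrable_const
      filter_upwards [(measure_eq_zero_iff_ae_notMem.1 (measure_singleton (μ := volume) t))]
        with s hst hs'
      exact hM _ _ ((hs s ⟨hs'.1.le, lt_of_le_of_ne hs'.2 hst⟩).trans_le hρr) (hur u hu s)
    have h2 : ∫ _ in (0 : ℝ)..t, M = M * t := by simp [mul_comm]
    have h3 : M * t ≤ M * η := mul_le_mul_of_nonneg_left ht.2 hM0.le
    have h4 := norm_add_le x (∫ s in (0 : ℝ)..t, S.f (ξ s) (u s))
    rw [← (hξ t ht.1).2] at h4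
    linarith
  refine ⟨η, hη, hbd, fun x₁ x₂ u ξ₁ ξ₂ hx₁ hx₂ hu h₁ h₂ => ?_⟩
  have hb₁ : ∀ s ∈ Ico 0 η, ‖ξ₁ s‖ < r := fun s hs =>
    (hbd x₁ u ξ₁ hx₁ hu h₁ s (Ico_subset_Icc_self hs)).trans_le hρr
  have hb₂ : ∀ s ∈ Ico 0 η, ‖ξ₂ s‖ < r := fun s hs =>
    (hbd x₂ u ξ₂ hx₂ hu h₂ s (Ico_subset_Icc_self hs)).trans_le hρr
  have h3 := h₁.norm_sub_sub_le h₂ hη.le (fun _ _ => rfl) (hur u hu) hL hb₁ hb₂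
  have h4 := h₁.norm_sub_le h₂ hη.le (fun _ _ => rfl) (hur u hu) hL0.le hL hb₁ hb₂
  have hcont : ContinuousOn (fun s => ‖ξ₁ s - ξ₂ s‖) (Icc 0 η) :=
    ((h₁.continuousOn η).sub (h₂.continuousOn η)).norm
  have h5 : ∫ s in (0 : ℝ)..η, ‖ξ₁ s - ξ₂ s‖ ≤ ∫ _ in (0 : ℝ)..η, 3 * ‖x₁ - x₂‖ := by
    refine intervalIntegral.integral_mono_on hη.le ?_ intervalIntegrable_const fun s hs => ?_
    · rw [← uIcc_of_le hη.le] at hcont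
      exact hcont.intervalIntegrable
    · refine (h4 s hs).trans ?_
      rw [mul_comm]
      refine mul_le_mul_of_nonneg_right ?_ (norm_nonneg _)
      have h6 : L * s ≤ 1 := by
        linarith [mul_le_mul_of_nonneg_left hs.2 hL0.le]
      exact (Real.exp_le_exp.2 h6).trans (by linarith [Real.exp_one_lt_d9])
  have h6 : ∫ _ in (0 : ℝ)..η, 3 * ‖x₁ - x₂‖ = η * (3 * ‖x₁ - x₂‖) := by
    rw [intervalIntegral.integral_const, sub_zero, smul_eq_mul]
  rw [h6] at h5
  calc _ ≤ L * (η * (3 * ‖x₁ - x₂‖)) := h3.trans (mul_le_mul_of_nonneg_left h5 hL0.le)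
    _ = L * η * (3 * ‖x₁ - x₂‖) := by ring
    _ ≤ 1 / 8 * (3 * ‖x₁ - x₂‖) := mul_le_mul_of_nonneg_right hηL (by positivity)
    _ ≤ _ := by linarith [norm_nonneg (x₁ - x₂)]

end FinSystem

/-! ### Bounded reachability sets -/

namespace FinSystem

variable {n m : ℕ} {Y : Type*} [NormedAddCommGroup Y]
variable {S : FinSystem n m Y} {p : Euc n} {R T : ℝ}

/-- The trajectories from `p` with inputs bounded by `R` are bounded on `[0, T]`, uniformly in
the input. -/
def BoundedReach (S : FinSystem n m Y) (R T : ℝ) (p : Euc n) : Prop :=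
  ∃ B, ∀ u ξ, Admissible R u → S.IsTrajectory p u ξ → ∀ t ∈ Icc 0 T, ‖ξ t‖ ≤ B

/-- Grönwall along the trajectory from `p` with the same input: the bound on these trajectories
fixes one Lipschitz constant for all inputs, hence a neighbourhood independent of the input. -/
theorem BoundedReach.exists_nhds (h : S.BoundedReach R T p) :
    ∃ δ, 0 < δ ∧ ∃ B, ∀ q, ‖p - q‖ < δ → (∀ u, Admissible R u → ∃ ξ, S.IsTrajectory p u ξ) →
      ∀ u ξ, Admissible R u → S.IsTrajectory q u ξ → ∀ t ∈ Icc 0 T, ‖ξ t‖ ≤ B := by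
  obtain ⟨B, hB⟩ := h
  obtain ⟨L, hL0, hL⟩ := S.lipschitz (|B| + |R| + 1) (by positivity)
  refine ⟨Real.exp (-(L * T)), Real.exp_pos _, B + 1, fun q hq hex u ξ hu hξ t ht => ?_⟩
  obtain ⟨ξ₀, hξ₀⟩ := hex u hu
  have hlt : ‖p - q‖ * Real.exp (L * T) < 1 := by
    have := mul_lt_mul_of_pos_right hq (Real.exp_pos (L * T))
    rwa [← Real.exp_add, neg_add_cancel, Real.exp_zero] at this
  have h1 := hξ₀.norm_sub_le_of_mul_exp_lt hξ (T := T) (r := |B| + |R| + 1) (fun _ _ => rfl)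
    (fun s => by linarith [hu.norm_le s, le_abs_self R, abs_nonneg B]) hL0.le hL
    (fun s hs => by linarith [hB u ξ₀ hu hξ₀ s hs, le_abs_self B, abs_nonneg R]) hlt t ht
  have h2 : ‖p - q‖ * Real.exp (L * t) ≤ ‖p - q‖ * Real.exp (L * T) := by
    gcongr
    exact ht.2
  have h3 := norm_sub_norm_le (ξ t) (ξ₀ t)
  rw [norm_sub_rev] at h3
  linarith [hB u ξ₀ hu hξ₀ t ht]

theorem ForwardComplete.exists_bound_of_isCompact (hFC : S.ForwardComplete) {K : Set (Euc n)}
    (hK : IsCompact K) (h : ∀ p ∈ K, S.BoundedReach R T p) :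
    ∃ B, ∀ q ∈ K, ∀ u ξ, Admissible R u → S.IsTrajectory q u ξ → ∀ t ∈ Icc 0 T, ‖ξ t‖ ≤ B := by
  refine hK.induction_on (p := fun s => ∃ B, ∀ q ∈ s, ∀ u ξ, Admissible R u →
    S.IsTrajectory q u ξ → ∀ t ∈ Icc 0 T, ‖ξ t‖ ≤ B) ⟨0, by simp⟩ ?_ ?_ ?_
  · rintro s t hst ⟨B, hB⟩
    exact ⟨B, fun q hq => hB q (hst hq)⟩
  · rintro s t ⟨B₁, h₁⟩ ⟨B₂, h₂⟩
    refine ⟨max B₁ B₂, fun q hq u ξ hu hξ t ht => ?_⟩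
    rcases hq with hq | hq
    · exact (h₁ q hq u ξ hu hξ t ht).trans (le_max_left _ _)
    · exact (h₂ q hq u ξ hu hξ t ht).trans (le_max_right _ _)
  · intro p hp
    obtain ⟨δ, hδ, B, hB⟩ := (h p hp).exists_nhds
    refine ⟨Metric.ball p δ, mem_nhdsWithin_of_mem_nhds (Metric.ball_mem_nhds p hδ), B,
      fun q hq u ξ hu hξ => hB q ?_ (fun u hu => hFC.exists_isTrajectory hu p) u ξ hu hξ⟩
    rw [← dist_eq_norm, dist_comm]
    exact hq

theorem IsTrajectory.continuous_initial (hu : Admissible R u) {Ξ : Euc n → ℝ → Euc n}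
    (hΞ : ∀ x, S.IsTrajectory x u (Ξ x)) {t : ℝ} (ht : 0 ≤ t) : Continuous fun x => Ξ x t := by
  rw [Metric.continuous_iff']
  intro p ε hε
  obtain ⟨B, hB⟩ := isCompact_Icc.exists_bound_of_continuousOn ((hΞ p).continuousOn t)
  obtain ⟨L, hL0, hL⟩ := S.lipschitz (|B| + |R| + 1) (by positivity)
  have hc : Filter.Tendsto (fun x => ‖p - x‖ * Real.exp (L * t)) (nhds p) (nhds 0) := by
    have : Continuous fun x => ‖p - x‖ * Real.exp (L * t) := by fun_prop
    simpa using this.tendsto p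
  filter_upwards [hc.eventually_lt_const one_pos, hc.eventually_lt_const hε] with x h1 h2
  have h3 := (hΞ p).norm_sub_le_of_mul_exp_lt (hΞ x) (T := t) (r := |B| + |R| + 1)
    (fun _ _ => rfl) (fun s => by linarith [hu.norm_le s, le_abs_self R, abs_nonneg B]) hL0.le hL
    (fun s hs => by linarith [hB s hs, le_abs_self B, abs_nonneg R]) h1 t ⟨ht, le_rfl⟩
  rw [dist_comm, dist_eq_norm]
  exact h3.trans_lt h2

/-- Unboundedness of the reachable set is passed on, after a short time, to some limit of
reachable states. -/
theorem ForwardComplete.exists_not_boundedReach (hFC : S.ForwardComplete) {η B : ℝ} (hη : 0 ≤ η)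
    (hbd : ∀ u ξ, Admissible R u → S.IsTrajectory p u ξ → ∀ t ∈ Icc 0 η, ‖ξ t‖ ≤ B)
    (h : ¬ S.BoundedReach R T p) :
    η < T ∧ ∀ ε, 0 < ε → ∃ q, ¬ S.BoundedReach R (T - η) q ∧
      ∃ u ξ, Admissible R u ∧ S.IsTrajectory p u ξ ∧ ‖ξ η - q‖ < ε := by
  have hηT : η < T := by
    by_contra! hT
    exact h ⟨B, fun u ξ hu hξ t ht => hbd u ξ hu hξ t ⟨ht.1, ht.2.trans hT⟩⟩
  refine ⟨hηT, fun ε hε => ?_⟩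
  let A : Set (Euc n) := {q | ∃ u ξ, Admissible R u ∧ S.IsTrajectory p u ξ ∧ ξ η = q}
  have hA : IsCompact (closure A) := by
    refine (Metric.isBounded_closedBall (x := (0 : Euc n)) (r := B)).subset ?_ |>.isCompact_closure
    rintro _ ⟨u, ξ, hu, hξ, rfl⟩
    simpa using hbd u ξ hu hξ η ⟨hη, le_rfl⟩
  -- Otherwise compactness gives one bound for the remaining time from all states of `A`, and
  -- appending it to the bound on `[0, η]` contradicts `h`.
  have hex : ∃ q ∈ closure A, ¬ S.BoundedReach R (T - η) q := by
    by_contra! hcon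
    obtain ⟨B', hB'⟩ := hFC.exists_bound_of_isCompact hA hcon
    refine h ⟨max B B', fun u ξ hu hξ t ht => ?_⟩
    rcases le_total t η with htη | htη
    · exact (hbd u ξ hu hξ t ⟨ht.1, htη⟩).trans (le_max_left _ _)
    · have := hB' (ξ η) (subset_closure ⟨u, ξ, hu, hξ, rfl⟩) _ _ (hu.shift η) (hξ.shift hη)
        (t - η) ⟨by linarith, by linarith [ht.2]⟩
      rw [sub_add_cancel] at this
      exact this.trans (le_max_right _ _)
  obtain ⟨q, hq, hqb⟩ := hex
  obtain ⟨_, ⟨u, ξ, hu, hξ, rfl⟩, hd⟩ := Metric.mem_closure_iff.1 hq ε hε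
  refine ⟨q, hqb, u, ξ, hu, hξ, ?_⟩
  rwa [← dist_eq_norm, dist_comm]

/-- Countably many input functions can be played one after the other. -/
theorem exists_admissible_concat {w : ℕ → ℝ → Euc m} (hw : ∀ j, Admissible R (w j)) {t : ℕ → ℝ}
    (ht : Monotone t) :
    ∃ u, Admissible R u ∧ ∀ j, ∀ s ∈ Ico 0 (t (j + 1) - t j), u (s + t j) = w j s := by
  have hR : 0 ≤ R := (norm_nonneg _).trans ((hw 0).norm_le 0)
  obtain ⟨g, hg, hgw⟩ := exists_measurable_piecewise (fun j => Ico (t j) (t (j + 1)))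
    (fun _ => measurableSet_Ico) (fun j s => w j (s - t j))
    (fun j => (hw j).measurable.comp (measurable_id.sub_const _))
    (fun i j hij s hs => absurd hs (by
      have := (ht.pairwise_disjoint_on_Ico_succ) hij
      exact fun hs' => (Set.disjoint_left.1 this) hs'.1 hs'.2))
  have hs : MeasurableSet {s | ‖g s‖ ≤ R} := measurableSet_le hg.norm measurable_const
  -- The glued function is uncontrolled outside the union of the intervals, hence the cut-off.
  refine ⟨indicator {s | ‖g s‖ ≤ R} g, ⟨hg.indicator hs, fun s => ?_⟩, fun j s hs => ?_⟩
  · by_cases h : ‖g s‖ ≤ R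
    · simp [h]
    · simpa [h] using hR
  · have h1 : g (s + t j) = w j s := by
      have := hgw j (x := s + t j) ⟨by linarith [hs.1], by linarith [hs.2]⟩
      simpa using this
    have h2 : ‖g (s + t j)‖ ≤ R := h1 ▸ (hw j).norm_le s
    rw [indicator_of_mem (show s + t j ∈ {s | ‖g s‖ ≤ R} from h2), h1]

/-- A forward complete system has bounded reachability sets from every state. -/
theorem ForwardComplete.boundedReach (hFC : S.ForwardComplete) (R T : ℝ) (p : Euc n) :
    S.BoundedReach R T p := by
  by_contra hp
  -- Step lengths depend only on an integer bound `k` for the norm. The radius `k + 1` leaves room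
  -- for the balls of radius at most `1` around the `P j`.
  choose η hη hbd hnear using fun k : ℕ => hFC.exists_short_time (S := S) R (k + 1)
  choose Ξ hΞ using fun (u : {u : ℝ → Euc m // Admissible R u}) (x : Euc n) =>
    hFC.exists_isTrajectory u.2 x
  let κ : Euc n → ℕ := fun x => ⌈‖x‖⌉₊
  have hκ : ∀ x, ‖x‖ ≤ κ x := fun x => Nat.le_ceil _
  have hstep : ∀ (a : {a : Euc n × ℝ // ¬ S.BoundedReach R a.2 a.1}) (j : ℕ),
      ∃ (b : {a : Euc n × ℝ // ¬ S.BoundedReach R a.2 a.1})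
        (w : {u : ℝ → Euc m // Admissible R u}),
        b.1.2 = a.1.2 - η (κ a.1.1) ∧ 0 < b.1.2 ∧
          ‖Ξ w a.1.1 (η (κ a.1.1)) - b.1.1‖ < (1 / 4) ^ (j + 1) := by
    rintro ⟨⟨q, T'⟩, hq⟩ j
    obtain ⟨h1, h2⟩ := hFC.exists_not_boundedReach (hη (κ q)).le (fun u ξ hu hξ t ht =>
      (hbd (κ q) q u ξ ((hκ q).trans (by linarith)) hu hξ t ht).le) hq
    obtain ⟨q', hq', u, ξ, hu, hξ, hd⟩ := h2 ((1 / 4) ^ (j + 1)) (by positivity)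
    refine ⟨⟨(q', T' - η (κ q)), hq'⟩, ⟨u, hu⟩, rfl, sub_pos.2 h1, ?_⟩
    rwa [(hΞ ⟨u, hu⟩ q).eq_of_eqOn hξ (fun _ _ => rfl) hu (η (κ q)) ⟨(hη _).le, le_rfl⟩]
  choose nxt ctl hnxt hpos hdist using hstep
  let a : ℕ → {a : Euc n × ℝ // ¬ S.BoundedReach R a.2 a.1} :=
    fun j => Nat.rec ⟨(p, T), hp⟩ (fun j a => nxt a j) j
  let P : ℕ → Euc n := fun j => (a j).1.1
  let k : ℕ → ℕ := fun j => κ (P j)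
  let w : ℕ → {u : ℝ → Euc m // Admissible R u} := fun j => ctl (a j) j
  let t : ℕ → ℝ := fun j => T - (a j).1.2
  have ht0 : t 0 = 0 := sub_self T
  have htsucc : ∀ j, t (j + 1) - t j = η (k j) := fun j => by
    have := hnxt (a j) j
    change (a (j + 1)).1.2 = (a j).1.2 - η (k j) at this
    simp only [t]
    linarith
  have htT : ∀ j, t (j + 1) ≤ T := fun j => by
    have : 0 < (a (j + 1)).1.2 := hpos (a j) j
    simp only [t]
    linarith
  have htmono : Monotone t := monotone_nat_of_le_succ fun j => by
    linarith [htsucc j, hη (k j)]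
  have ht0' : ∀ j, 0 ≤ t j := fun j => ht0 ▸ htmono (Nat.zero_le j)
  let F : ℕ → Euc n → Euc n := fun j x => Ξ (w j) x (η (k j))
  have hFP : ∀ j, dist (F j (P j)) (P (j + 1)) < (1 / 4) ^ (j + 1) := fun j => by
    rw [dist_eq_norm]
    exact hdist (a j) j
  have hball : ∀ j, ∀ x ∈ Metric.closedBall (P j) ((1 / 4 : ℝ) ^ j), ‖x‖ ≤ k j + 1 := by
    intro j x hx
    have h1 : ((1 / 4 : ℝ)) ^ j ≤ 1 := pow_le_one₀ (by norm_num) (by norm_num)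
    have h2 : ‖x - P j‖ ≤ 1 := by
      rw [← dist_eq_norm]; exact (Metric.mem_closedBall.1 hx).trans h1
    have h3 := norm_sub_norm_le x (P j)
    have h4 := hκ (P j)
    simp only [k]
    linarith
  obtain ⟨x, hx⟩ := exists_forall_iterateSeq_mem (F := F)
    (C := fun j => Metric.closedBall (P j) ((1 / 4 : ℝ) ^ j))
    (fun j => IsTrajectory.continuous_initial (w j).2 (hΞ (w j)) (hη _).le)
    (fun j => isCompact_closedBall _ _)
    (fun j => ⟨P j, Metric.mem_closedBall_self (by positivity)⟩)
    (fun j => by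
      -- The image contains a ball of radius `(1/4)^j / 2` about `F j (P j)`. Half of this absorbs
      -- the jump to `P (j + 1)`, and the other half is the next radius `(1/4)^(j+1)`.
      refine (surjOn_closedBall_of_norm_sub_sub_le (by positivity) fun y hy z hz =>
        hnear (k j) y z _ _ _ (hball j y hy) (hball j z hz) (w j).2 (hΞ _ y) (hΞ _ z)).mono
        Subset.rfl (Metric.closedBall_subset_closedBall' ?_)
      have h1 := hFP j
      rw [dist_comm] at h1
      have h2 : ((1 / 4 : ℝ)) ^ (j + 1) = (1 / 4) ^ j / 4 := by ring
      change _ ≤ (1 / 4 : ℝ) ^ j / 2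
      linarith)
  obtain ⟨u, hu, huw⟩ := exists_admissible_concat (fun j => (w j).2) htmono
  obtain ⟨ξ, hξ⟩ := hFC.exists_isTrajectory hu x
  have hξt : ∀ j, ξ (t j) = iterateSeq F j x := fun j => by
    induction j with
    | zero => rw [ht0, hξ.map_zero]; rfl
    | succ j ih =>
      have h1 := (hξ.shift (ht0' j)).eq_of_eqOn (hΞ (w j) (ξ (t j))) (T := η (k j))
        (fun s hs => huw j s (by rwa [htsucc])) (hu.shift _) (η (k j)) ⟨(hη _).le, le_rfl⟩
      have h2 : η (k j) + t j = t (j + 1) := by linarith [htsucc j]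
      simp only [h2] at h1
      rw [h1, ih]
      rfl
  obtain ⟨M, hM⟩ := isCompact_Icc.exists_bound_of_continuousOn (hξ.continuousOn T)
  have htT' : ∀ j, t j ≤ T := fun j => (htmono j.le_succ).trans (htT j)
  have hk : ∀ j, k j ≤ ⌈M + 1⌉₊ := fun j => by
    refine Nat.ceil_le_ceil ?_
    have h1 : dist (ξ (t j)) (P j) ≤ (1 / 4 : ℝ) ^ j := by rw [hξt]; exact hx j
    have h2 : ((1 / 4 : ℝ)) ^ j ≤ 1 := pow_le_one₀ (by norm_num) (by norm_num)
    rw [dist_comm, dist_eq_norm] at h1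
    linarith [norm_sub_norm_le (P j) (ξ (t j)), hM (t j) ⟨ht0' j, htT' j⟩]
  -- Only finitely many values of `k j` occur, so the step lengths have a positive lower bound and
  -- `t j` grows at least linearly.
  obtain ⟨k₀, -, hmin⟩ := Finset.exists_min_image (Finset.range (⌈M + 1⌉₊ + 1)) η ⟨0, by simp⟩
  have hgrow : ∀ j : ℕ, j * η k₀ ≤ t j := fun j => by
    induction j with
    | zero => simp [ht0]
    | succ j ih =>
      have h1 := hmin (k j) (Finset.mem_range.2 (Nat.lt_succ_of_le (hk j)))
      push_cast
      linarith [htsucc j]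
  obtain ⟨j, hj⟩ := exists_nat_gt (T / η k₀)
  rw [div_lt_iff₀ (hη k₀)] at hj
  linarith [hgrow j, htT' j]

/-- A forward complete system has bounded reachability sets, uniformly over bounded sets of
initial states, inputs and times. -/
theorem ForwardComplete.exists_norm_flow_le (hFC : S.ForwardComplete) (ρ R T : ℝ) :
    ∃ B, ∀ (x : Euc n) (U : InputSpace m), ‖x‖ ≤ ρ → ‖U‖ ≤ R → ∀ t ∈ Icc 0 T,
      ‖S.flow t x U‖ ≤ B := by
  obtain ⟨B, hB⟩ := hFC.exists_bound_of_isCompact (isCompact_closedBall (0 : Euc n) ρ)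
    fun p _ => hFC.boundedReach R T p
  refine ⟨B, fun x U hx hU t ht => ?_⟩
  obtain ⟨u, ξ, hu, hξ, he⟩ := hFC.exists_isTrajectory_flow x U hU
  rw [he t ht.1]
  exact hB x (by simpa using hx) u ξ hu hξ t ht

theorem ForwardComplete.exists_norm_output_le (hFC : S.ForwardComplete) (ρ R T : ℝ) :
    ∃ B, ∀ (x : Euc n) (U : InputSpace m), ‖x‖ ≤ ρ → ‖U‖ ≤ R → ∀ t ∈ Icc 0 T,
      ‖S.output t x U‖ ≤ B := by
  obtain ⟨B, hB⟩ := hFC.exists_norm_flow_le ρ R T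
  obtain ⟨B', hB'⟩ := (isCompact_closedBall (0 : Euc n) B).exists_bound_of_continuousOn
    S.continuous_h.continuousOn
  exact ⟨B', fun x U hx hU t ht => hB' _ (by simpa using hB x U hx hU t ht)⟩

end FinSystem

/-! ### Enlarging the gain and removing the bound on the input -/

/-- A class `K_∞` function can be enlarged to dominate given bounds away from zero. -/
theorem IsClassKInf.exists_ge {γ : ℝ≥0 → ℝ≥0} (hγ : IsClassKInf γ) (c : ℕ → ℝ) :
    ∃ γ' : ℝ≥0 → ℝ≥0, IsClassKInf γ' ∧ (∀ s, γ s ≤ γ' s) ∧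
      ∀ s : ℝ≥0, 1 ≤ s → c ⌈s⌉₊ ≤ γ' s := by
  let D : ℕ → ℝ := fun k => ∑ i ∈ Finset.range (k + 1), |c i|
  have hD : Monotone D := fun i j hij =>
    Finset.sum_le_sum_of_subset_of_nonneg (Finset.range_subset_range.2 (by omega))
      fun _ _ _ => abs_nonneg _
  have hD0 : ∀ k, 0 ≤ D k := fun k => Finset.sum_nonneg fun _ _ => abs_nonneg _
  have hcD : ∀ k, c k ≤ D k := fun k => (le_abs_self _).trans
    (Finset.single_le_sum (f := fun i => |c i|) (fun _ _ => abs_nonneg _) (by simp))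
  -- The shift by `1` ensures `D ⌈s⌉₊ ≤ g (s - 1)`, so the integral of `g` over `[s - 1, s]` already
  -- dominates `c ⌈s⌉₊`.
  let g : ℝ → ℝ := fun s => D (⌈s⌉₊ + 1)
  have hg : Monotone g := fun s t hst => hD (by gcongr)
  have hgi : ∀ a b, IntervalIntegrable g volume a b := fun _ _ => hg.intervalIntegrable
  let θ : ℝ → ℝ := fun s => ∫ t in (0 : ℝ)..s, g t
  have hθc : Continuous θ := intervalIntegral.continuous_primitive hgi 0
  have hθm : Monotone θ := fun s t hst => by
    have h1 : θ t - θ s = ∫ r in s..t, g r :=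
      intervalIntegral.integral_interval_sub_left (hgi _ _) (hgi _ _)
    have h2 : 0 ≤ ∫ r in s..t, g r := intervalIntegral.integral_nonneg hst fun _ _ => hD0 _
    linarith
  have hθ : ∀ s : ℝ≥0, 1 ≤ s → c ⌈s⌉₊ ≤ θ s := fun s hs => by
    have hs' : (1 : ℝ) ≤ s := hs
    have h1 : θ s - θ (s - 1) = ∫ r in ((s : ℝ) - 1)..s, g r :=
      intervalIntegral.integral_interval_sub_left (hgi _ _) (hgi _ _)
    have h2 : ∫ _ in ((s : ℝ) - 1)..s, g (s - 1) ≤ ∫ r in ((s : ℝ) - 1)..s, g r :=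
      intervalIntegral.integral_mono_on (by linarith) intervalIntegrable_const (hgi _ _)
        fun r hr => hg hr.1
    have h3 : 0 ≤ θ (s - 1) := by
      have h := hθm (show (0 : ℝ) ≤ s - 1 by linarith)
      simpa [θ] using h
    have h4 : D ⌈s⌉₊ ≤ g (s - 1) := hD (by
      have h5 : (s : ℝ) ≤ ((⌈(s : ℝ) - 1⌉₊ + 1 : ℕ) : ℝ) := by
        push_cast
        linarith [Nat.le_ceil ((s : ℝ) - 1)]
      exact Nat.ceil_le.2 (by exact_mod_cast h5))
    simp at h2
    linarith [hcD ⌈s⌉₊]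
  refine ⟨fun s => γ s + (θ s).toNNReal, ⟨?_, ?_, ?_, ?_⟩, fun s => le_self_add, fun s hs => ?_⟩
  · simp [hγ.map_zero, θ]
  · exact hγ.continuous.add (continuous_real_toNNReal.comp (hθc.comp NNReal.continuous_coe))
  · exact hγ.strictMono.add_monotone fun s t hst => Real.toNNReal_le_toNNReal (hθm hst)
  · rintro ⟨b, hb⟩
    refine hγ.unbounded ⟨b, ?_⟩
    rintro _ ⟨s, rfl⟩
    exact le_self_add.trans (hb ⟨s, rfl⟩)
  · push_cast
    exact (hθ s hs).trans ((Real.le_coe_toNNReal _).trans (le_add_of_nonneg_left (γ s).2))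

section AsymptoticGain

variable {X Input Y : Type*} [NormedAddCommGroup X] [NormedAddCommGroup Input]
  [NormedAddCommGroup Y] {y : ℝ → X → Input → Y}

theorem OGUAG.ouag (h : OGUAG y) : OUAG y := by
  obtain ⟨γ, hγ, h⟩ := h
  refine ⟨γ, hγ, fun ε r s hε hr _ => ?_⟩
  obtain ⟨τ, hτ, hy⟩ := h ε r hε hr
  exact ⟨τ, hτ, fun x hx u _ => hy x hx u⟩

/-- If the outputs are bounded over bounded sets of states, inputs and times, the output-uniform
asymptotic gain property can be made uniform over all inputs. -/
theorem OUAG.oguag (h : OUAG y)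
    (hb : ∀ ρ T : ℝ, ∃ B, ∀ x u, ‖x‖ ≤ ρ → ‖u‖ ≤ ρ → ∀ t ∈ Icc 0 T, ‖y t x u‖ ≤ B) :
    OGUAG y := by
  obtain ⟨γ, hγ, h⟩ := h
  have hc : ∀ k : ℕ, ∃ c : ℝ, ∀ x u, ‖x‖ ≤ k → ‖u‖ ≤ k → ∀ t, 0 ≤ t → ‖y t x u‖ ≤ c := by
    intro k
    obtain ⟨τ, -, hτ⟩ := h 1 (k + 1) (k + 1) one_pos (by positivity) (by positivity)
    obtain ⟨B, hB⟩ := hb k τ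
    refine ⟨max B (1 + γ k), fun x u hx hu t ht => ?_⟩
    rcases le_total t τ with htτ | htτ
    · exact (hB x u hx hu t ⟨ht, htτ⟩).trans (le_max_left _ _)
    · refine (hτ x (by linarith) u (by linarith) t htτ).trans (le_trans ?_ (le_max_right _ _))
      have : γ ‖u‖₊ ≤ γ k := hγ.strictMono.monotone (by exact_mod_cast hu)
      have : (γ ‖u‖₊ : ℝ) ≤ γ k := this
      linarith
  choose c hc using hc
  obtain ⟨γ', hγ', hle, hge⟩ := hγ.exists_ge c
  refine ⟨γ', hγ', fun ε r hε hr => ?_⟩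
  -- From `‖u‖ ≥ max r 1` on, `‖u‖` also bounds `‖x‖`, so `c ⌈‖u‖₊⌉₊` applies; the `1` is there
  -- because `γ'` dominates `c` only from `1` onwards.
  obtain ⟨τ, hτ0, hτ⟩ := h ε (max r 1) (max r 1) hε (by positivity) (by positivity)
  refine ⟨τ, hτ0, fun x hx u t ht => ?_⟩
  rcases lt_or_ge ‖u‖ (max r 1) with hu | hu
  · have h1 := hτ x (hx.trans_le (le_max_left _ _)) u hu t ht
    have h2 : (γ ‖u‖₊ : ℝ) ≤ γ' ‖u‖₊ := hle _
    linarith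
  · have h1 : ‖u‖ ≤ ⌈‖u‖₊⌉₊ := by exact_mod_cast Nat.le_ceil ‖u‖₊
    have h2 := hc ⌈‖u‖₊⌉₊ x u (hx.le.trans ((le_max_left _ _).trans (hu.trans h1))) h1 t
      (hτ0.trans ht)
    have h3 := hge ‖u‖₊ (by exact_mod_cast (le_max_right _ _).trans hu)
    linarith

end AsymptoticGain

end OutputStability

theorem mainTheorem9 {n m : ℕ} {Y : Type*} [NormedAddCommGroup Y] [NormedSpace ℝ Y]
    (S : OutputStability.FinSystem n m Y) (hFC : S.ForwardComplete) :
    OutputStability.OUAG S.output ↔ OutputStability.OGUAG S.output :=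
  ⟨fun h => h.oguag fun ρ T => hFC.exists_norm_output_le ρ ρ T, fun h => h.ouag⟩
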